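/- Let $r>0$, $x_0,\hat x\in\mathbb{R}$, let $\nu$ be a measure on $(0,\infty)$ with $M_k:=\int_0^\infty z^k\,\nu(dz)<\infty$ for $k=1,2$, and let $N$ be a Poisson random measure on $(0,\infty)\times(0,\infty)$ with intensity $\nu(dz)\,dt$ on a probability space; write $\tilde N(dz,dt)=N(dz,dt)-\nu(dz)\,dt$. For $0\le t<1$ put $$A_t:=\frac{2r}{e^{2r(1-t)}-1},\qquad B_t:=\frac{2r\left(-\hat x+\frac{M_1}{r}\bigl(1-e^{-r(1-t)}\bigr)\right)}{e^{r(1-t)}\bigl(1-e^{-2r(1-t)}\bigr)} .$$ (i) These are the limits of the coefficients of the penalized linear-quadratic control problem: for every $F>0$ the terminal value problem $$\frac{dA_{t,F}}{dt}=A_{t,F}^2+2rA_{t,F},\qquad \frac{dB_{t,F}}{dt}=(r+A_{t,F})B_{t,F}-M_1A_{t,F}\quad(0\le t<1),\qquad A_{1,F}=F,\quad B_{1,F}=-F\hat x,$$ has a solution continuous on $[0,1]$, and for any such solutions $A_{t,F}\to A_t$ and $B_{t,F}\to B_t$ as $F\to+\infty$, for every $t\in[0,1)$. (ii) Let $X^*=(X^*_t)_{0\le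 t<1}$ be a jump Ornstein–Uhlenbeck bridge, i.e. a solution of $$dX^*_t=\bigl(-(r+A_t)X^*_t-B_t+M_1\bigr)\,dt+\int_0^{\infty}z\,\tilde N(dz,dt),\qquad X^*_0=x_0 ,$$ on $[0,1)$. Then $\lim_{t\to1-}X^*_t=\hat x$ almost surely. -/

import Mathlib

open MeasureTheory ProbabilityTheory Set Filter Topology
open scoped ENNReal NNReal

noncomputable section

/-- `ν` is the Lévy measure of a pure-jump subordinator with finite first and second moments: it is
carried by `(0, ∞)`, and `∫ z ν(dz)` and `∫ z² ν(dz)` are finite. The measure `ν` itself may be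
infinite (infinite activity). -/
structure IsSubordinatorLevyMeasure (ν : Measure ℝ) : Prop where
  carried_by_pos : ν (Iic 0) = 0
  integrable_id : Integrable (fun z : ℝ => z) ν
  integrable_sq : Integrable (fun z : ℝ => z ^ 2) ν

/-- The moments `M_k = ∫ z^k ν(dz)` over `(0, ∞)`. -/
def levyMoment (ν : Measure ℝ) (k : ℕ) : ℝ := ∫ z in Ioi (0 : ℝ), z ^ k ∂ν

/-- `N` is a Poisson random measure on `E` with intensity (compensator) `μ`, on the probability
space `(Ω, P)`: a random measure such that `N A` is Poisson with parameter `μ A` whenever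
`μ A < ∞`, and `N (A 0), …, N (A (n-1))` are independent for disjoint measurable sets. -/
structure IsPoissonRandomMeasure {Ω E : Type*} [MeasurableSpace Ω] [MeasurableSpace E]
    (P : Measure Ω) (μ : Measure E) (N : Ω → Measure E) : Prop where
  measurable : Measurable N
  hasLaw : ∀ A : Set E, MeasurableSet A → μ A < ∞ →
    HasLaw (fun ω => N ω A)
      ((poissonMeasure (μ A).toNNReal).map (fun n : ℕ => (n : ℝ≥0∞))) P
  indep : ∀ (n : ℕ) (A : Fin n → Set E), (∀ i, MeasurableSet (A i)) →
    Pairwise (fun i j => Disjoint (A i) (A j)) →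
    iIndepFun (fun (i : Fin n) (ω : Ω) => N ω (A i)) P

/-- The intensity `ν(dz) ds` on jump sizes `z` and times `s > 0` (in this order). -/
def jumpIntensity (ν : Measure ℝ) : Measure (ℝ × ℝ) :=
  ν.prod ((volume : Measure ℝ).restrict (Ioi 0))

/-- The compensated jump integral
`∫_(0,t] ∫_(0,∞) z Ñ(dz, ds)`, with `Ñ(dz, ds) = N(dz, ds) - ν(dz) ds`. As the jumps have a finite
first moment, both integrals converge absolutely (the first one almost surely). -/
def compensatedJumpIntegral {Ω : Type*} (ν : Measure ℝ) (N : Ω → Measure (ℝ × ℝ))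
    (t : ℝ) (ω : Ω) : ℝ :=
  (∫ p in Ioi (0 : ℝ) ×ˢ Ioc (0 : ℝ) t, p.1 ∂(N ω))
    - ∫ p in Ioi (0 : ℝ) ×ˢ Ioc (0 : ℝ) t, p.1 ∂(jumpIntensity ν)

/-- The functions `A_{t,F}`, `B_{t,F}` solve the Riccati system of the linear-quadratic problem with
terminal penalty `F`: `A' = A² + 2rA`, `B' = (r + A)B - M₁A` on `[0,1)`, with `A_{1,F} = F` and
`B_{1,F} = -F x̂`. -/
structure IsRiccatiSolution (r M₁ xhat F : ℝ) (A B : ℝ → ℝ) : Prop where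
  continuousOn_A : ContinuousOn A (Icc 0 1)
  continuousOn_B : ContinuousOn B (Icc 0 1)
  deriv_A : ∀ t ∈ Ico (0 : ℝ) 1,
    HasDerivWithinAt A (A t ^ 2 + 2 * r * A t) (Icc 0 1) t
  deriv_B : ∀ t ∈ Ico (0 : ℝ) 1,
    HasDerivWithinAt B ((r + A t) * B t - M₁ * A t) (Icc 0 1) t
  terminal_A : A 1 = F
  terminal_B : B 1 = -F * xhat

/-- The limit coefficient `A_t = 2r / (exp(2r(1-t)) - 1)`, for `t < 1`. -/
def bridgeA (r t : ℝ) : ℝ := 2 * r / (Real.exp (2 * r * (1 - t)) - 1)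

/-- The limit coefficient
`B_t = 2r (-x̂ + (M₁/r)(1 - exp(-r(1-t)))) / (exp(r(1-t)) (1 - exp(-2r(1-t))))`, for `t < 1`. -/
def bridgeB (r M₁ xhat t : ℝ) : ℝ :=
  2 * r * (-xhat + M₁ / r * (1 - Real.exp (-r * (1 - t))))
    / (Real.exp (r * (1 - t)) * (1 - Real.exp (-2 * r * (1 - t))))

/-- `X` is a solution on `[0, 1)`, started at `x₀`, of
`dX_t = (-(r + A_t) X_t - B_t + M₁) dt + ∫_(0,∞) z Ñ(dz, dt)`:
almost surely the integrated equation holds simultaneously for all `t ∈ [0, 1)`, the paths being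
integrable on `[0, t]`. (The paths of such a solution are automatically càdlàg on `[0, 1)`, and,
the equation being pathwise and uniquely solvable, automatically adapted up to null sets.) -/
def IsOUBridge {Ω : Type*} [MeasurableSpace Ω] (P : Measure Ω) (ν : Measure ℝ)
    (N : Ω → Measure (ℝ × ℝ)) (r x₀ xhat : ℝ) (X : ℝ → Ω → ℝ) : Prop :=
  ∀ᵐ ω ∂P, ∀ t ∈ Ico (0 : ℝ) 1,
    IntervalIntegrable (fun s => X s ω) volume 0 t ∧
    X t ω = x₀
      + (∫ s in (0 : ℝ)..t, (-(r + bridgeA r s) * X s ω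
          - bridgeB r (levyMoment ν 1) xhat s + levyMoment ν 1))
      + compensatedJumpIntegral ν N t ω

end

/-!
The Riccati system is solved in closed form. With `D = (F + 2r) e^{r(1-t)} - F e^{-r(1-t)}`, which
satisfies `D' = -(r + A) D` and is positive, `A D` and `B D` are elementary
(`isRiccatiSolution_explicit`), and letting `F → ∞` in `D / F` gives the limit coefficients. The
solution is unique (`IsRiccatiSolution.unique`): the difference of two solutions satisfies a
homogeneous linear equation with zero terminal value.

The terminal constraint is a pathwise statement. The mean measure of a Poisson random measure is its
intensity (`IsPoissonRandomMeasure.lintegral_lintegral`), so `∫ z ν(dz) < ∞` makes the jumps almost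
surely summable on `(0, 1]` (`ae_integrableOn_jumps`). Hence the sum `L_t` of the jumps up to time
`t` is finite and monotone, and has a left limit `L_{1-}`. The compensator cancels the drift `M₁`,
and `V = X - (L - L_{1-})` is absolutely continuous with `V' = -(r + A) X - B`. Since
`r + A_t = r coth (r (1 - t))`, the function `1 / sinh (r (1 - t))` is an integrating factor, and
`V_t` is a vanishing term plus `sinh (r (1 - t)) ∫₀ᵗ r (x̂ + e_s) / sinh² (r (1 - s)) ds` with
`e_s → 0` as `s → 1`. As `coth (r (1 - t))` is a primitive of `r / sinh² (r (1 - t))`, these are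
averages with total weight tending to `1` that concentrate at time `1`
(`tendsto_weighted_average_zero`), so they tend to `x̂`; see `tendsto_of_bridge_equation`.
-/

/-! ### The Riccati system -/

/-- Uniqueness for a linear terminal value problem whose equation is only imposed before the
terminal time. -/
lemma eq_zero_of_linear_terminal {c d : ℝ → ℝ} (hc : ContinuousOn c (Icc 0 1))
    (hd : ContinuousOn d (Icc 0 1))
    (hderiv : ∀ t ∈ Ico (0 : ℝ) 1, HasDerivWithinAt d (c t * d t) (Icc 0 1) t)
    (h1 : d 1 = 0) : ∀ t ∈ Icc (0 : ℝ) 1, d t = 0 := by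
  -- a globally continuous extension of `c`, so that its primitive is differentiable everywhere
  let c' : ℝ → ℝ := fun t => c (projIcc 0 1 zero_le_one t)
  have hc' : Continuous c' := hc.comp_continuous
    (continuous_subtype_val.comp continuous_projIcc) fun t => (projIcc 0 1 zero_le_one t).2
  have hcc : ∀ t ∈ Icc (0 : ℝ) 1, c' t = c t := fun t ht => by
    simp only [c', projIcc_of_mem _ ht]
  let E : ℝ → ℝ := fun t => ∫ s in (0 : ℝ)..t, c' s
  have hE : ∀ t, HasDerivAt E (c' t) t := fun t => hc'.integral_hasStrictDerivAt 0 t |>.hasDerivAt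
  have hEc : Continuous E := continuous_iff_continuousAt.2 fun t => (hE t).continuousAt
  have hconst : ∀ t ∈ Icc (0 : ℝ) 1, d t * Real.exp (-E t) = d 0 * Real.exp (-E 0) := by
    apply constant_of_has_deriv_right_zero (f := fun t => d t * Real.exp (-E t))
    · exact hd.mul (by fun_prop)
    · intro t ht
      have h := (hderiv t ht).mul ((hE t).neg.exp.hasDerivWithinAt (s := Icc 0 1))
      refine (h.mono_of_mem_nhdsWithin (Icc_mem_nhdsGE_of_mem ht)).congr_deriv ?_
      rw [hcc t (Ico_subset_Icc_self ht)]
      simp only [Pi.neg_apply]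
      ring
  have h0 : d 0 * Real.exp (-E 0) = 0 := by
    rw [← hconst 1 (by simp), h1, zero_mul]
  intro t ht
  have := hconst t ht
  rw [h0] at this
  simpa using this

/-- The common denominator of the explicit solutions of the Riccati system; it solves
`D' = -(r + A) D`. -/
noncomputable def riccatiDenom (r F t : ℝ) : ℝ :=
  (F + 2 * r) * Real.exp (r * (1 - t)) - F * Real.exp (-(r * (1 - t)))

/-- The explicit first component `A_{t,F}` of the solution of the Riccati system. -/
noncomputable def riccatiA (r F t : ℝ) : ℝ :=
  2 * r * F * Real.exp (-(r * (1 - t))) / riccatiDenom r F t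

/-- The explicit second component `B_{t,F}` of the solution of the Riccati system. -/
noncomputable def riccatiB (r m xhat F t : ℝ) : ℝ :=
  2 * F * (-r * xhat + m * (1 - Real.exp (-(r * (1 - t))))) / riccatiDenom r F t

lemma riccatiDenom_pos {r F t : ℝ} (hr : 0 < r) (hF : 0 < F) (ht : t ≤ 1) :
    0 < riccatiDenom r F t := by
  have h1 : Real.exp (-(r * (1 - t))) ≤ Real.exp (r * (1 - t)) := by
    apply Real.exp_le_exp.2
    nlinarith [mul_nonneg hr.le (sub_nonneg.2 ht)]
  have h2 := Real.exp_pos (r * (1 - t))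
  unfold riccatiDenom
  nlinarith

lemma hasDerivAt_exp_remaining (a t : ℝ) :
    HasDerivAt (fun s => Real.exp (a * (1 - s))) (-a * Real.exp (a * (1 - t))) t := by
  have h : HasDerivAt (fun s : ℝ => a * (1 - s)) (-a) t := by
    simpa using ((hasDerivAt_id t).const_sub 1).const_mul a
  simpa [mul_comm] using h.exp

lemma hasDerivAt_riccatiDenom (r F t : ℝ) :
    HasDerivAt (riccatiDenom r F) (-r * ((F + 2 * r) * Real.exp (r * (1 - t))
      + F * Real.exp (-(r * (1 - t))))) t := by
  have h1 := (hasDerivAt_exp_remaining r t).const_mul (F + 2 * r)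
  have h2 := (hasDerivAt_exp_remaining (-r) t).const_mul F
  simp only [neg_mul] at h2
  exact (h1.sub h2).congr_deriv (by ring)

lemma isRiccatiSolution_explicit {r F : ℝ} (hr : 0 < r) (hF : 0 < F) (m xhat : ℝ) :
    IsRiccatiSolution r m xhat F (riccatiA r F) (riccatiB r m xhat F) := by
  have hA : ∀ t ≤ 1, HasDerivAt (riccatiA r F)
      (riccatiA r F t ^ 2 + 2 * r * riccatiA r F t) t := by
    intro t ht
    have hD := (riccatiDenom_pos hr hF ht).ne'
    have h2 := (hasDerivAt_exp_remaining (-r) t).const_mul (2 * r * F)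
    simp only [neg_mul] at h2
    refine (h2.div (hasDerivAt_riccatiDenom r F t) hD).congr_deriv ?_
    unfold riccatiA
    field_simp
    unfold riccatiDenom
    ring
  have hB : ∀ t ≤ 1, HasDerivAt (riccatiB r m xhat F)
      ((r + riccatiA r F t) * riccatiB r m xhat F t - m * riccatiA r F t) t := by
    intro t ht
    have hD := (riccatiDenom_pos hr hF ht).ne'
    have h2 := ((((hasDerivAt_exp_remaining (-r) t).const_sub 1).const_mul m).const_add
      (-r * xhat)).const_mul (2 * F)
    have h3 := h2.div (hasDerivAt_riccatiDenom r F t) hD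
    have hfun : riccatiB r m xhat F = (fun y => 2 * F * (-r * xhat + m *
        (1 - Real.exp (-r * (1 - y))))) / riccatiDenom r F := by
      ext s
      simp only [riccatiB, Pi.div_apply, neg_mul]
    rw [← hfun] at h3
    refine h3.congr_deriv ?_
    simp only [neg_mul r]
    unfold riccatiA riccatiB
    field_simp
    unfold riccatiDenom
    ring
  refine ⟨fun t ht => (hA t ht.2).continuousAt.continuousWithinAt,
    fun t ht => (hB t ht.2).continuousAt.continuousWithinAt,
    fun t ht => (hA t ht.2.le).hasDerivWithinAt, fun t ht => (hB t ht.2.le).hasDerivWithinAt,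
    ?_, ?_⟩
  · simp only [riccatiA, riccatiDenom, sub_self, mul_zero, neg_zero, Real.exp_zero]
    field_simp
    ring
  · simp only [riccatiB, riccatiDenom, sub_self, mul_zero, neg_zero, Real.exp_zero]
    field_simp
    ring

/-- Two solutions of the Riccati equation differ by a solution of a linear equation, because
`x² - y² = (x + y)(x - y)`; this gives uniqueness of `A`, and then of `B`. -/
lemma IsRiccatiSolution.unique {r m xhat F : ℝ} {A B A' B' : ℝ → ℝ}
    (h : IsRiccatiSolution r m xhat F A B) (h' : IsRiccatiSolution r m xhat F A' B') :
    EqOn A A' (Icc 0 1) ∧ EqOn B B' (Icc 0 1) := by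
  have hA : EqOn A A' (Icc 0 1) := by
    intro t ht
    refine sub_eq_zero.1 (eq_zero_of_linear_terminal (c := fun t => A t + A' t + 2 * r)
      (d := fun t => A t - A' t) ?_ (h.continuousOn_A.sub h'.continuousOn_A) ?_ ?_ t ht)
    · exact (h.continuousOn_A.add h'.continuousOn_A).add continuousOn_const
    · exact fun s hs => ((h.deriv_A s hs).sub (h'.deriv_A s hs)).congr_deriv (by ring)
    · simp [h.terminal_A, h'.terminal_A]
  refine ⟨hA, fun t ht => ?_⟩
  refine sub_eq_zero.1 (eq_zero_of_linear_terminal (c := fun t => r + A t)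
    (d := fun t => B t - B' t) (continuousOn_const.add h.continuousOn_A)
    (h.continuousOn_B.sub h'.continuousOn_B) ?_ ?_ t ht)
  · refine fun s hs => ((h.deriv_B s hs).sub (h'.deriv_B s hs)).congr_deriv ?_
    rw [← hA (Ico_subset_Icc_self hs)]
    ring
  · simp [h.terminal_B, h'.terminal_B]

lemma exp_neg_lt_exp_remaining {r t : ℝ} (hr : 0 < r) (ht : t < 1) :
    Real.exp (-(r * (1 - t))) < Real.exp (r * (1 - t)) := by
  apply Real.exp_lt_exp.2
  nlinarith [mul_pos hr (sub_pos.2 ht)]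

lemma tendsto_riccatiDenom_div (r t : ℝ) :
    Tendsto (fun F => riccatiDenom r F t / F) atTop
      (𝓝 (Real.exp (r * (1 - t)) - Real.exp (-(r * (1 - t))))) := by
  have h0 : Tendsto (fun F : ℝ => 2 * r * Real.exp (r * (1 - t)) * F⁻¹) atTop (𝓝 0) := by
    simpa using tendsto_inv_atTop_zero.const_mul (2 * r * Real.exp (r * (1 - t)))
  have h1 := h0.const_add (Real.exp (r * (1 - t)) - Real.exp (-(r * (1 - t))))
  rw [add_zero] at h1
  refine h1.congr' ?_
  filter_upwards [eventually_gt_atTop 0] with F hF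
  unfold riccatiDenom
  field_simp
  ring

lemma bridgeA_eq {r t : ℝ} (hr : 0 < r) (ht : t < 1) :
    bridgeA r t = 2 * r * Real.exp (-(r * (1 - t)))
      / (Real.exp (r * (1 - t)) - Real.exp (-(r * (1 - t)))) := by
  have h := exp_neg_lt_exp_remaining hr ht
  have he : Real.exp (2 * r * (1 - t)) = Real.exp (r * (1 - t)) * Real.exp (r * (1 - t)) := by
    rw [← Real.exp_add]; congr 1; ring
  have hp := Real.exp_pos (r * (1 - t))
  rw [Real.exp_neg] at h ⊢
  have h2 : 1 < Real.exp (r * (1 - t)) * Real.exp (r * (1 - t)) := by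
    rwa [inv_lt_iff_one_lt_mul₀ hp] at h
  unfold bridgeA
  rw [he, div_eq_div_iff (by linarith) (by linarith)]
  field_simp

lemma bridgeB_eq {r : ℝ} (hr : 0 < r) (m xhat t : ℝ) :
    bridgeB r m xhat t = 2 * (-r * xhat + m * (1 - Real.exp (-(r * (1 - t)))))
      / (Real.exp (r * (1 - t)) - Real.exp (-(r * (1 - t)))) := by
  have he : Real.exp (r * (1 - t)) * (1 - Real.exp (-2 * r * (1 - t)))
      = Real.exp (r * (1 - t)) - Real.exp (-(r * (1 - t))) := by
    rw [mul_sub, ← Real.exp_add, mul_one]; congr 2; ring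
  unfold bridgeB
  rw [he, neg_mul r]
  congr 1
  field_simp

lemma tendsto_riccatiA {r t : ℝ} (hr : 0 < r) (ht : t < 1) :
    Tendsto (fun F => riccatiA r F t) atTop (𝓝 (bridgeA r t)) := by
  rw [bridgeA_eq hr ht]
  have hne := (sub_pos.2 (exp_neg_lt_exp_remaining hr ht)).ne'
  refine ((tendsto_const_nhds (x := 2 * r * Real.exp (-(r * (1 - t))))).div
    (tendsto_riccatiDenom_div r t) hne).congr' ?_
  filter_upwards [eventually_gt_atTop 0] with F hF
  have hD := (riccatiDenom_pos hr hF ht.le).ne'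
  simp only [Pi.div_apply, riccatiA]
  field_simp

lemma tendsto_riccatiB {r t : ℝ} (hr : 0 < r) (ht : t < 1) (m xhat : ℝ) :
    Tendsto (fun F => riccatiB r m xhat F t) atTop (𝓝 (bridgeB r m xhat t)) := by
  rw [bridgeB_eq hr]
  have hne := (sub_pos.2 (exp_neg_lt_exp_remaining hr ht)).ne'
  refine ((tendsto_const_nhds
    (x := 2 * (-r * xhat + m * (1 - Real.exp (-(r * (1 - t))))))).div
    (tendsto_riccatiDenom_div r t) hne).congr' ?_
  filter_upwards [eventually_gt_atTop 0] with F hF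
  have hD := (riccatiDenom_pos hr hF ht.le).ne'
  simp only [Pi.div_apply, riccatiB]
  field_simp

/-! ### Convergence of the bridge along one path -/

/-- A Toeplitz-type averaging lemma: if `h t * ∫₀ᵗ k` stays bounded and `h → 0`, then averaging a
function that vanishes at `1` against the weights `h t * k` gives a function that vanishes
at `1`. -/
lemma tendsto_weighted_average_zero {h k e : ℝ → ℝ} {C : ℝ}
    (hk : ∀ s ∈ Ico (0 : ℝ) 1, 0 ≤ k s) (hh : ∀ s ∈ Ico (0 : ℝ) 1, 0 ≤ h s)
    (hki : ∀ t ∈ Ico (0 : ℝ) 1, IntervalIntegrable k volume 0 t)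
    (hke : ∀ t ∈ Ico (0 : ℝ) 1, IntervalIntegrable (fun s => k s * e s) volume 0 t)
    (hC : ∀ t ∈ Ico (0 : ℝ) 1, h t * ∫ s in (0 : ℝ)..t, k s ≤ C)
    (h0 : Tendsto h (𝓝[<] 1) (𝓝 0)) (e0 : Tendsto e (𝓝[<] 1) (𝓝 0)) :
    Tendsto (fun t => h t * ∫ s in (0 : ℝ)..t, k s * e s) (𝓝[<] 1) (𝓝 0) := by
  have hC0 : 0 ≤ C := by simpa using hC 0 (by simp)
  rw [Metric.tendsto_nhds]
  intro η hη
  let δ : ℝ := η / (2 * (C + 1))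
  have hδ : 0 < δ := by positivity
  have hδC : δ * C < η / 2 := by
    have : δ * (C + 1) = η / 2 := by simp only [δ]; field_simp
    nlinarith
  obtain ⟨a, ha1, ha⟩ : ∃ a < (1 : ℝ), ∀ s ∈ Ioo a 1, |e s| < δ := by
    have := Metric.tendsto_nhds.1 e0 δ hδ
    obtain ⟨a, ha, h⟩ := (mem_nhdsLT_iff_exists_Ioo_subset).1 this
    exact ⟨a, ha, fun s hs => by simpa using h hs⟩
  let t₀ : ℝ := max a 0
  have ht₀ : t₀ ∈ Ico (0 : ℝ) 1 := ⟨le_max_right _ _, max_lt ha1 one_pos⟩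
  have hfirst : Tendsto (fun t => h t * ∫ s in (0 : ℝ)..t₀, k s * e s) (𝓝[<] 1) (𝓝 0) := by
    simpa using h0.mul_const (∫ s in (0 : ℝ)..t₀, k s * e s)
  filter_upwards [Metric.tendsto_nhds.1 hfirst (η / 2) (by positivity), Ioo_mem_nhdsLT ht₀.2]
    with t h1 ht
  have htI : t ∈ Ico (0 : ℝ) 1 := ⟨ht₀.1.trans ht.1.le, ht.2⟩
  have hint : IntervalIntegrable (fun s => k s * e s) volume t₀ t :=
    (hke t₀ ht₀).symm.trans (hke t htI)
  have hkint : IntervalIntegrable k volume t₀ t := (hki t₀ ht₀).symm.trans (hki t htI)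
  have hsecond : |∫ s in t₀..t, k s * e s| ≤ δ * ∫ s in (0 : ℝ)..t, k s := by
    calc |∫ s in t₀..t, k s * e s| ≤ ∫ s in t₀..t, δ * k s := by
          rw [← Real.norm_eq_abs]
          refine intervalIntegral.norm_integral_le_of_norm_le ht.1.le ?_ (hkint.const_mul δ)
          refine Eventually.of_forall fun s hs => ?_
          have hs1 : s < 1 := hs.2.trans_lt ht.2
          have hk' := hk s ⟨ht₀.1.trans hs.1.le, hs1⟩
          rw [Real.norm_eq_abs, abs_mul, abs_of_nonneg hk', mul_comm]
          exact mul_le_mul_of_nonneg_right (ha s ⟨(le_max_left _ _).trans_lt hs.1, hs1⟩).le hk'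
      _ = δ * ∫ s in t₀..t, k s := intervalIntegral.integral_const_mul _ _
      _ ≤ δ * ∫ s in (0 : ℝ)..t, k s := by
          gcongr
          rw [← intervalIntegral.integral_add_adjacent_intervals (hki t₀ ht₀) hkint]
          have := intervalIntegral.integral_nonneg (μ := volume) ht₀.1
            fun s hs => hk s ⟨hs.1, hs.2.trans_lt ht₀.2⟩
          linarith
  rw [Real.dist_eq, sub_zero] at h1 ⊢
  rw [← intervalIntegral.integral_add_adjacent_intervals (hke t₀ ht₀) hint, mul_add]
  calc _ ≤ |h t * ∫ s in (0 : ℝ)..t₀, k s * e s| + |h t * ∫ s in t₀..t, k s * e s| :=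
        abs_add_le _ _
    _ ≤ |h t * ∫ s in (0 : ℝ)..t₀, k s * e s| + δ * C := by
        gcongr
        rw [abs_mul, abs_of_nonneg (hh t htI)]
        calc _ ≤ h t * (δ * ∫ s in (0 : ℝ)..t, k s) := by
              gcongr; exact hh t htI
          _ = δ * (h t * ∫ s in (0 : ℝ)..t, k s) := by ring
          _ ≤ δ * C := by gcongr; exact hC t htI
    _ < η := by linarith

lemma sinh_remaining_pos {r t : ℝ} (hr : 0 < r) (ht : t < 1) : 0 < Real.sinh (r * (1 - t)) :=
  Real.sinh_pos_iff.2 (mul_pos hr (sub_pos.2 ht))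

lemma add_bridgeA_eq {r t : ℝ} (hr : 0 < r) (ht : t < 1) :
    r + bridgeA r t = r * Real.cosh (r * (1 - t)) / Real.sinh (r * (1 - t)) := by
  have h := sub_pos.2 (exp_neg_lt_exp_remaining hr ht)
  rw [bridgeA_eq hr ht, Real.cosh_eq, Real.sinh_eq]
  field_simp
  ring

lemma bridgeB_eq_sinh {r : ℝ} (hr : 0 < r) (m xhat t : ℝ) :
    bridgeB r m xhat t = r * (-xhat + m / r * (1 - Real.exp (-(r * (1 - t)))))
      / Real.sinh (r * (1 - t)) := by
  rw [bridgeB_eq hr, Real.sinh_eq, div_div_eq_mul_div]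
  congr 1
  field_simp

lemma hasDerivAt_sinh_remaining (r t : ℝ) :
    HasDerivAt (fun s => Real.sinh (r * (1 - s))) (-r * Real.cosh (r * (1 - t))) t := by
  have h : HasDerivAt (fun s : ℝ => r * (1 - s)) (-r) t := by
    simpa using ((hasDerivAt_id t).const_sub 1).const_mul r
  simpa [mul_comm] using h.sinh

lemma hasDerivAt_cosh_remaining (r t : ℝ) :
    HasDerivAt (fun s => Real.cosh (r * (1 - s))) (-r * Real.sinh (r * (1 - t))) t := by
  have h : HasDerivAt (fun s : ℝ => r * (1 - s)) (-r) t := by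
    simpa using ((hasDerivAt_id t).const_sub 1).const_mul r
  simpa [mul_comm] using h.cosh

/-- `1 / sinh (r (1 - t))` is an integrating factor for the bridge: its logarithmic derivative is
`r + A_t`. -/
lemma hasDerivAt_inv_sinh_remaining {r t : ℝ} (hr : 0 < r) (ht : t < 1) :
    HasDerivAt (fun s => (Real.sinh (r * (1 - s)))⁻¹)
      ((r + bridgeA r t) * (Real.sinh (r * (1 - t)))⁻¹) t := by
  have h := sinh_remaining_pos hr ht
  refine ((hasDerivAt_sinh_remaining r t).inv h.ne').congr_deriv ?_
  rw [add_bridgeA_eq hr ht]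
  field_simp

lemma continuousOn_inv_sinh_remaining {r : ℝ} (hr : 0 < r) :
    ContinuousOn (fun s => (Real.sinh (r * (1 - s)))⁻¹) (Iio 1) :=
  fun _ hs => (hasDerivAt_inv_sinh_remaining hr hs).continuousAt.continuousWithinAt

lemma uIcc_zero_subset_Iio {t : ℝ} (ht : t ∈ Ico (0 : ℝ) 1) : uIcc 0 t ⊆ Iio 1 := by
  rw [uIcc_of_le ht.1]
  exact fun s hs => hs.2.trans_lt ht.2

lemma integral_inv_sinh_sq {r t : ℝ} (hr : 0 < r) (ht : t ∈ Ico (0 : ℝ) 1) :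
    ∫ s in (0 : ℝ)..t, r * (Real.sinh (r * (1 - s)))⁻¹ ^ 2
      = Real.cosh (r * (1 - t)) / Real.sinh (r * (1 - t)) - Real.cosh r / Real.sinh r := by
  have hderiv : ∀ s ∈ uIcc 0 t,
      HasDerivAt (fun s => Real.cosh (r * (1 - s)) / Real.sinh (r * (1 - s)))
        (r * (Real.sinh (r * (1 - s)))⁻¹ ^ 2) s := by
    intro s hs
    have h := sinh_remaining_pos hr (uIcc_zero_subset_Iio ht hs)
    refine ((hasDerivAt_cosh_remaining r s).div (hasDerivAt_sinh_remaining r s)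
      h.ne').congr_deriv ?_
    field_simp
    have := Real.cosh_sq (r * (1 - s))
    linarith
  rw [intervalIntegral.integral_eq_sub_of_hasDerivAt hderiv]
  · simp
  · exact (continuousOn_const.mul (((continuousOn_inv_sinh_remaining hr).mono
      (uIcc_zero_subset_Iio ht)).pow 2)).intervalIntegrable

lemma continuousOn_add_bridgeA {r : ℝ} (hr : 0 < r) :
    ContinuousOn (fun s => r + bridgeA r s) (Iio 1) := by
  have : ContinuousOn (fun s => r * Real.cosh (r * (1 - s)) * (Real.sinh (r * (1 - s)))⁻¹)
      (Iio 1) :=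
    ContinuousOn.mul (by fun_prop) (continuousOn_inv_sinh_remaining hr)
  exact this.congr fun s hs => by rw [add_bridgeA_eq hr hs, div_eq_mul_inv]

lemma continuousOn_bridgeB {r : ℝ} (hr : 0 < r) (m xhat : ℝ) :
    ContinuousOn (bridgeB r m xhat) (Iio 1) := by
  have : ContinuousOn (fun s => r * (-xhat + m / r * (1 - Real.exp (-(r * (1 - s)))))
      * (Real.sinh (r * (1 - s)))⁻¹) (Iio 1) :=
    ContinuousOn.mul (by fun_prop) (continuousOn_inv_sinh_remaining hr)
  exact this.congr fun s hs => by rw [bridgeB_eq_sinh hr, div_eq_mul_inv]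

/-- Variation of constants, for an absolutely continuous `c + ∫ f` and an integrating factor `q`
with `q' = a q`. -/
lemma integrating_factor_formula {f q a : ℝ → ℝ} {t : ℝ} (c : ℝ) (ht : 0 ≤ t)
    (hf : IntervalIntegrable f volume 0 t)
    (hq : ∀ s ∈ Icc 0 t, HasDerivAt q (a s * q s) s) (ha : ContinuousOn a (Icc 0 t)) :
    (c + ∫ s in (0 : ℝ)..t, f s) * q t = c * q 0
      + ∫ s in (0 : ℝ)..t, q s * (f s + a s * (c + ∫ u in (0 : ℝ)..s, f u)) := by
  have hqc : ContinuousOn q (Icc 0 t) := fun s hs => (hq s hs).continuousAt.continuousWithinAt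
  have hf' : AbsolutelyContinuousOnInterval (fun x => ∫ s in (0 : ℝ)..x, f s) 0 t :=
    hf.absolutelyContinuousOnInterval_intervalIntegral (by simp)
  have hcc : AbsolutelyContinuousOnInterval (fun _ : ℝ => c) 0 t :=
    ContDiffOn.absolutelyContinuousOnInterval contDiffOn_const
  have hqq : AbsolutelyContinuousOnInterval q 0 t := by
    have hq' : ContinuousOn (fun s => a s * q s) (Icc 0 t) := ha.mul hqc
    obtain ⟨K, hK⟩ := isCompact_Icc.exists_bound_of_continuousOn hq'
    refine LipschitzOnWith.absolutelyContinuousOnInterval (K := K.toNNReal) ?_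
    rw [uIcc_of_le ht]
    refine (convex_Icc 0 t).lipschitzOnWith_of_nnnorm_hasDerivWithin_le
      (fun s hs => (hq s hs).hasDerivWithinAt) fun s hs => ?_
    exact NNReal.le_toNNReal_of_coe_le (hK s hs)
  have key := AbsolutelyContinuousOnInterval.integral_deriv_mul_eq_sub (hcc.add hf') hqq
  have hcongr : ∫ s in (0 : ℝ)..t, q s * (f s + a s * (c + ∫ u in (0 : ℝ)..s, f u))
      = ∫ s in (0 : ℝ)..t, deriv ((fun _ : ℝ => c) + fun x => ∫ s in (0 : ℝ)..x, f s) s * q s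
        + ((fun _ : ℝ => c) + fun x => ∫ s in (0 : ℝ)..x, f s) s * deriv q s := by
    refine intervalIntegral.integral_congr_ae ?_
    filter_upwards [hf.ae_hasDerivAt_integral] with s hs hst
    have hs' : s ∈ uIcc 0 t := uIoc_subset_uIcc hst
    have h1 := ((hs hs' 0 (by simp)).const_add c).deriv
    have h2 := (hq s (by rwa [uIcc_of_le ht] at hs')).deriv
    have h3 : deriv ((fun _ : ℝ => c) + fun x => ∫ s in (0 : ℝ)..x, f s) s = f s := h1
    rw [h3, h2]
    simp only [Pi.add_apply]
    ring
  rw [hcongr, key]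
  simp

/-- The terminal constraint along one path: `L` is the path of the sum of the jumps, whose
oscillation dies out at time `1`, so that the mean reversion, of rate about `1 / (1 - t)`, wins. -/
lemma tendsto_of_bridge_equation {r : ℝ} (hr : 0 < r) (m xhat x₀ : ℝ) {L X : ℝ → ℝ}
    (hL : Monotone L)
    (hX : ∀ t ∈ Ico (0 : ℝ) 1, IntervalIntegrable X volume 0 t ∧
      X t = x₀ + (∫ s in (0 : ℝ)..t, (-(r + bridgeA r s) * X s - bridgeB r m xhat s)) + L t) :
    Tendsto X (𝓝[<] 1) (𝓝 xhat) := by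
  obtain ⟨l, hl⟩ : ∃ l, Tendsto L (𝓝[<] 1) (𝓝 l) := ⟨_, hL.tendsto_nhdsLT 1⟩
  let f : ℝ → ℝ := fun s => -(r + bridgeA r s) * X s - bridgeB r m xhat s
  let q : ℝ → ℝ := fun s => (Real.sinh (r * (1 - s)))⁻¹
  let R : ℝ → ℝ := fun s => L s - l
  have hR : Tendsto R (𝓝[<] 1) (𝓝 0) := by simpa [R] using hl.sub_const l
  have hf : ∀ t ∈ Ico (0 : ℝ) 1, IntervalIntegrable f volume 0 t := fun t ht =>
    ((hX t ht).1.continuousOn_mul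
      ((continuousOn_add_bridgeA hr).neg.mono (uIcc_zero_subset_Iio ht))).sub
      ((continuousOn_bridgeB hr m xhat).mono (uIcc_zero_subset_Iio ht)).intervalIntegrable
  -- `X - R` is absolutely continuous
  have hV : ∀ t ∈ Ico (0 : ℝ) 1, X t - R t = (x₀ + l) + ∫ s in (0 : ℝ)..t, f s := by
    intro t ht
    rw [(hX t ht).2]
    simp only [R, f]
    ring
  -- the part of the forcing term that vanishes at time `1`
  let e : ℝ → ℝ := fun s =>
    -(Real.cosh (r * (1 - s)) * R s) - m / r * (1 - Real.exp (-(r * (1 - s))))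
  have he : Tendsto e (𝓝[<] 1) (𝓝 0) := by
    have h1 : Tendsto (fun s : ℝ => Real.cosh (r * (1 - s))) (𝓝[<] 1) (𝓝 1) := by
      have : Continuous fun s : ℝ => Real.cosh (r * (1 - s)) := by fun_prop
      simpa using (this.tendsto 1).mono_left nhdsWithin_le_nhds
    have h2 : Tendsto (fun s : ℝ => m / r * (1 - Real.exp (-(r * (1 - s))))) (𝓝[<] 1) (𝓝 0) := by
      have : Continuous fun s : ℝ => m / r * (1 - Real.exp (-(r * (1 - s)))) := by fun_prop
      simpa using (this.tendsto 1).mono_left nhdsWithin_le_nhds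
    simpa using (h1.mul hR).neg.sub h2
  let k : ℝ → ℝ := fun s => r * q s ^ 2
  have hkc : ContinuousOn k (Iio 1) :=
    continuousOn_const.mul ((continuousOn_inv_sinh_remaining hr).pow 2)
  have hki : ∀ t ∈ Ico (0 : ℝ) 1, IntervalIntegrable k volume 0 t := fun t ht =>
    (hkc.mono (uIcc_zero_subset_Iio ht)).intervalIntegrable
  have hei : ∀ t : ℝ, IntervalIntegrable e volume 0 t := fun t =>
    (((hL.intervalIntegrable).sub intervalIntegrable_const).continuousOn_mul
      (Continuous.continuousOn (by fun_prop))).neg.sub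
      (Continuous.intervalIntegrable (by fun_prop) _ _)
  have hke : ∀ t ∈ Ico (0 : ℝ) 1, IntervalIntegrable (fun s => k s * e s) volume 0 t :=
    fun t ht => (hei t).continuousOn_mul (hkc.mono (uIcc_zero_subset_Iio ht))
  have hh0 : Tendsto (fun t : ℝ => Real.sinh (r * (1 - t))) (𝓝[<] 1) (𝓝 0) := by
    have : Continuous fun s : ℝ => Real.sinh (r * (1 - s)) := by fun_prop
    simpa using (this.tendsto 1).mono_left nhdsWithin_le_nhds
  have hsolve : ∀ t ∈ Ico (0 : ℝ) 1, X t - R t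
      = Real.sinh (r * (1 - t)) * ((x₀ + l) * q 0 - xhat * (Real.cosh r / Real.sinh r))
        + xhat * Real.cosh (r * (1 - t))
        + Real.sinh (r * (1 - t)) * ∫ s in (0 : ℝ)..t, k s * e s := by
    intro t ht
    have hs := sinh_remaining_pos hr ht.2
    have h1 := integrating_factor_formula (q := q) (a := fun s => r + bridgeA r s) (x₀ + l) ht.1
      (hf t ht) (fun s hs => hasDerivAt_inv_sinh_remaining hr (hs.2.trans_lt ht.2))
      ((continuousOn_add_bridgeA hr).mono fun s hs => hs.2.trans_lt ht.2)
    have h2 : ∫ s in (0 : ℝ)..t, q s * (f s + (r + bridgeA r s) *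
          ((x₀ + l) + ∫ u in (0 : ℝ)..s, f u))
        = ∫ s in (0 : ℝ)..t, (xhat * k s + k s * e s) := by
      refine intervalIntegral.integral_congr fun s hs => ?_
      have hs1 : s < 1 := uIcc_zero_subset_Iio ht hs
      rw [uIcc_of_le ht.1] at hs
      have hsp := sinh_remaining_pos hr hs1
      rw [← hV s ⟨hs.1, hs1⟩]
      simp only [f, k, e, q]
      rw [bridgeB_eq_sinh hr, add_bridgeA_eq hr hs1]
      field_simp
      ring
    rw [h2, intervalIntegral.integral_add ((hki t ht).const_mul xhat) (hke t ht),
      intervalIntegral.integral_const_mul, integral_inv_sinh_sq hr ht, ← hV t ht] at h1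
    have h3 : X t - R t = Real.sinh (r * (1 - t)) * ((X t - R t) * q t) := by
      simp only [q]; field_simp
    rw [h3, h1]
    field_simp
    ring
  have havg : Tendsto (fun t => Real.sinh (r * (1 - t)) * ∫ s in (0 : ℝ)..t, k s * e s)
      (𝓝[<] 1) (𝓝 0) := by
    refine tendsto_weighted_average_zero (C := Real.cosh r) (fun s _ => by positivity)
      (fun s hs => (sinh_remaining_pos hr hs.2).le) hki hke (fun t ht => ?_) hh0 he
    have hs := sinh_remaining_pos hr ht.2
    have hsr : 0 < Real.sinh r := Real.sinh_pos_iff.2 hr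
    rw [integral_inv_sinh_sq hr ht, mul_sub, mul_div_cancel₀ _ hs.ne']
    have h1 : Real.cosh (r * (1 - t)) ≤ Real.cosh r := by
      apply Real.cosh_le_cosh.2
      rw [abs_of_pos hr, abs_of_nonneg (mul_nonneg hr.le (sub_nonneg.2 ht.2.le))]
      nlinarith [ht.1]
    have h2 : 0 ≤ Real.sinh (r * (1 - t)) * (Real.cosh r / Real.sinh r) := by
      have := Real.cosh_pos r
      positivity
    linarith
  have hcosh : Tendsto (fun t : ℝ => xhat * Real.cosh (r * (1 - t))) (𝓝[<] 1) (𝓝 xhat) := by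
    have : Continuous fun s : ℝ => xhat * Real.cosh (r * (1 - s)) := by fun_prop
    simpa using (this.tendsto 1).mono_left nhdsWithin_le_nhds
  have hlim := (((hh0.mul_const ((x₀ + l) * q 0 - xhat * (Real.cosh r / Real.sinh r))).add
    hcosh).add havg).add hR
  simp only [zero_mul, zero_add, add_zero] at hlim
  refine hlim.congr' ?_
  filter_upwards [Ioo_mem_nhdsLT (zero_lt_one (α := ℝ))] with t ht
  have := hsolve t ⟨ht.1.le, ht.2⟩
  linarith

/-! ### The path of the sum of the jumps -/

lemma lintegral_cast_poissonMeasure (a : ℝ≥0) :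
    ∫⁻ n : ℕ, (n : ℝ≥0∞) ∂(poissonMeasure a) = a := by
  have hsum : HasSum (fun n : ℕ => Real.exp (-a) * a ^ n / n.factorial * n) (a : ℝ) := by
    rw [← hasSum_nat_add_iff' 1]
    have h := (hasSum_one_poissonMeasure a).mul_left (a : ℝ)
    simp only [Finset.range_one, Finset.sum_singleton, Nat.cast_zero, mul_zero, sub_zero]
    rw [mul_one] at h
    refine h.congr_fun fun n => ?_
    rw [Nat.factorial_succ]
    push_cast
    field_simp
    ring
  rw [poissonMeasure, lintegral_sum_measure]
  simp only [lintegral_smul_measure, lintegral_dirac, smul_eq_mul]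
  have h2 : ∀ n : ℕ, ENNReal.ofReal (Real.exp (-a) * a ^ n / n.factorial) * (n : ℝ≥0∞)
      = ENNReal.ofReal (Real.exp (-a) * a ^ n / n.factorial * n) := fun n => by
    rw [ENNReal.ofReal_mul (by positivity), ENNReal.ofReal_natCast]
  simp only [h2]
  rw [← ENNReal.ofReal_tsum_of_nonneg (fun n => by positivity) hsum.summable, hsum.tsum_eq,
    ENNReal.ofReal_coe_nnreal]

section RandomMeasure

variable {Ω E : Type*} [MeasurableSpace Ω] [MeasurableSpace E] {P : Measure Ω} {μ : Measure E}
  {N : Ω → Measure E}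

lemma IsPoissonRandomMeasure.bind_apply (hN : IsPoissonRandomMeasure P μ N) {A : Set E}
    (hA : MeasurableSet A) (hμ : μ A < ∞) : P.bind N A = μ A := by
  rw [Measure.bind_apply hA hN.measurable.aemeasurable,
    (hN.hasLaw A hA hμ).lintegral_comp (f := fun x => x) aemeasurable_id',
    lintegral_map measurable_id' .of_discrete]
  simp only [lintegral_cast_poissonMeasure]
  exact ENNReal.coe_toNNReal hμ.ne

/-- The first-moment (Campbell) formula on a countable union of sets of finite intensity: there the
mean measure of `N` agrees with the intensity. -/
lemma IsPoissonRandomMeasure.lintegral_lintegral (hN : IsPoissonRandomMeasure P μ N)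
    {S : ℕ → Set E} (hS : ∀ n, MeasurableSet (S n)) (hμ : ∀ n, μ (S n) < ∞) {f : E → ℝ≥0∞}
    (hf : Measurable f) :
    ∫⁻ ω, ∫⁻ p in ⋃ n, S n, f p ∂(N ω) ∂P = ∫⁻ p in ⋃ n, S n, f p ∂μ := by
  have hrestrict : (P.bind N).restrict (⋃ n, S n) = μ.restrict (⋃ n, S n) := by
    rw [Measure.restrict_iUnion_congr]
    intro n
    ext A hA
    rw [Measure.restrict_apply hA, Measure.restrict_apply hA]
    exact hN.bind_apply (hA.inter (hS n)) ((measure_mono inter_subset_right).trans_lt (hμ n))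
  have hU : MeasurableSet (⋃ n, S n) := MeasurableSet.iUnion hS
  rw [← hrestrict, ← lintegral_indicator hU,
    Measure.lintegral_bind hN.measurable.aemeasurable (hf.indicator hU).aemeasurable]
  simp only [lintegral_indicator hU]

end RandomMeasure

lemma IsSubordinatorLevyMeasure.measure_Ioi_lt_top {ν : Measure ℝ}
    (hν : IsSubordinatorLevyMeasure ν) {ε : ℝ} (hε : 0 < ε) : ν (Ioi ε) < ∞ :=
  hν.integrable_id.measure_gt_lt_top hε

lemma iUnion_Ioi_one_div : ⋃ n : ℕ, Ioi (1 / ((n : ℝ) + 1)) = Ioi 0 := by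
  ext z
  simp only [mem_iUnion, mem_Ioi]
  exact ⟨fun ⟨n, hn⟩ => lt_trans (by positivity) hn, exists_nat_one_div_lt⟩

lemma IsSubordinatorLevyMeasure.sigmaFinite {ν : Measure ℝ}
    (hν : IsSubordinatorLevyMeasure ν) : SigmaFinite ν := by
  refine ⟨⟨⟨fun n => Iic 0 ∪ Ioi (1 / ((n : ℝ) + 1)), fun _ => trivial, fun n => ?_, ?_⟩⟩⟩
  · exact measure_union_lt_top (by simp [hν.carried_by_pos])
      (hν.measure_Ioi_lt_top (by positivity))
  · rw [← union_iUnion, iUnion_Ioi_one_div, Iic_union_Ioi]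

lemma jumpIntensity_restrict (ν : Measure ℝ) [SigmaFinite ν] (s : Set ℝ) (t : ℝ) :
    (jumpIntensity ν).restrict (s ×ˢ Ioc (0 : ℝ) t)
      = (ν.restrict s).prod (volume.restrict (Ioc (0 : ℝ) t)) := by
  rw [jumpIntensity, ← Measure.prod_restrict, Measure.restrict_restrict measurableSet_Ioc,
    inter_eq_left.2 Ioc_subset_Ioi_self]

lemma setIntegral_jumpIntensity (ν : Measure ℝ) [SigmaFinite ν] {t : ℝ} (ht : 0 ≤ t) :
    ∫ p in Ioi (0 : ℝ) ×ˢ Ioc (0 : ℝ) t, p.1 ∂(jumpIntensity ν) = t * levyMoment ν 1 := by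
  rw [jumpIntensity_restrict, integral_fun_fst (fun z : ℝ => z)]
  simp [levyMoment, Measure.real, ht]

/-- As `∫ z ν(dz) < ∞`, the jumps are almost surely summable on `(0, 1]`. -/
lemma ae_integrableOn_jumps {Ω : Type*} [MeasurableSpace Ω] {P : Measure Ω} {ν : Measure ℝ}
    (hν : IsSubordinatorLevyMeasure ν) {N : Ω → Measure (ℝ × ℝ)}
    (hN : IsPoissonRandomMeasure P (jumpIntensity ν) N) :
    ∀ᵐ ω ∂P, IntegrableOn (fun p : ℝ × ℝ => p.1) (Ioi (0 : ℝ) ×ˢ Ioc (0 : ℝ) 1) (N ω) := by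
  have := hν.sigmaFinite
  -- the strip is exhausted by sets carrying only jumps bounded away from `0`
  have hU : ⋃ n : ℕ, Ioi (1 / ((n : ℝ) + 1)) ×ˢ Ioc (0 : ℝ) 1 = Ioi (0 : ℝ) ×ˢ Ioc (0 : ℝ) 1 := by
    rw [← iUnion_prod_const, iUnion_Ioi_one_div]
  have hf : Measurable fun p : ℝ × ℝ => ‖p.1‖ₑ := by fun_prop
  have key := hN.lintegral_lintegral
    (S := fun n : ℕ => Ioi (1 / ((n : ℝ) + 1)) ×ˢ Ioc (0 : ℝ) 1)
    (fun n => measurableSet_Ioi.prod measurableSet_Ioc) (fun n => ?_) hf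
  · rw [hU] at key
    have hfin : ∫⁻ p in Ioi (0 : ℝ) ×ˢ Ioc (0 : ℝ) 1, ‖p.1‖ₑ ∂(jumpIntensity ν) < ∞ := by
      rw [jumpIntensity_restrict]
      exact (hν.integrable_id.integrableOn.comp_fst _).hasFiniteIntegral
    have hmeas : Measurable fun ω => ∫⁻ p in Ioi (0 : ℝ) ×ˢ Ioc (0 : ℝ) 1, ‖p.1‖ₑ ∂(N ω) := by
      simp only [← lintegral_indicator (measurableSet_Ioi.prod measurableSet_Ioc)]
      exact (Measure.measurable_lintegral
        (hf.indicator (measurableSet_Ioi.prod measurableSet_Ioc))).comp hN.measurable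
    filter_upwards [ae_lt_top hmeas (key.trans_lt hfin).ne] with ω hω
    exact ⟨measurable_fst.aestronglyMeasurable, hω⟩
  · rw [← Measure.restrict_apply_univ, jumpIntensity_restrict, ← univ_prod_univ,
      Measure.prod_prod]
    simpa using hν.measure_Ioi_lt_top (ε := 1 / ((n : ℝ) + 1)) (by positivity)

lemma monotone_jumpSum {m : Measure (ℝ × ℝ)}
    (hm : IntegrableOn (fun p : ℝ × ℝ => p.1) (Ioi (0 : ℝ) ×ˢ Ioc (0 : ℝ) 1) m) :
    Monotone fun t : ℝ => ∫ p in Ioi (0 : ℝ) ×ˢ Ioc (0 : ℝ) (min t 1), p.1 ∂m := by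
  intro s t hst
  have hmeas : ∀ u : ℝ, MeasurableSet (Ioi (0 : ℝ) ×ˢ Ioc (0 : ℝ) u) := fun u =>
    measurableSet_Ioi.prod measurableSet_Ioc
  refine setIntegral_mono_set
    (hm.mono_set (prod_mono_right (Ioc_subset_Ioc_right (min_le_right _ _)))) ?_
    (prod_mono_right (Ioc_subset_Ioc_right (min_le_min_right _ hst))).eventuallyLE
  exact (ae_restrict_mem (hmeas _)).mono fun p hp => (mem_Ioi.1 hp.1).le

/-! ### The terminal constraint -/

lemma IsOUBridge.ae_tendsto {Ω : Type*} [MeasurableSpace Ω] {P : Measure Ω} {ν : Measure ℝ}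
    (hν : IsSubordinatorLevyMeasure ν) {N : Ω → Measure (ℝ × ℝ)}
    (hN : IsPoissonRandomMeasure P (jumpIntensity ν) N) {r x₀ xhat : ℝ} (hr : 0 < r)
    {X : ℝ → Ω → ℝ} (hX : IsOUBridge P ν N r x₀ xhat X) :
    ∀ᵐ ω ∂P, Tendsto (fun t => X t ω) (𝓝[<] 1) (𝓝 xhat) := by
  have := hν.sigmaFinite
  filter_upwards [hX, ae_integrableOn_jumps hν hN] with ω hω hm
  refine tendsto_of_bridge_equation hr (levyMoment ν 1) xhat x₀ (monotone_jumpSum hm)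
    fun t ht => ⟨(hω t ht).1, ?_⟩
  have hsub := uIcc_zero_subset_Iio ht
  -- the drift `M₁ t` cancels the compensator
  have hint : IntervalIntegrable (fun s => -(r + bridgeA r s) * X s ω
      - bridgeB r (levyMoment ν 1) xhat s) volume 0 t :=
    ((hω t ht).1.continuousOn_mul ((continuousOn_add_bridgeA hr).neg.mono hsub)).sub
      ((continuousOn_bridgeB hr (levyMoment ν 1) xhat).mono hsub).intervalIntegrable
  rw [(hω t ht).2, intervalIntegral.integral_add hint intervalIntegrable_const,
    compensatedJumpIntegral, setIntegral_jumpIntensity ν ht.1, min_eq_left ht.2.le,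
    intervalIntegral.integral_const, smul_eq_mul]
  ring

theorem proposition2 {Ω : Type*} [MeasurableSpace Ω] (P : Measure Ω) [IsProbabilityMeasure P]
    (ν : Measure ℝ) (hν : IsSubordinatorLevyMeasure ν)
    (N : Ω → Measure (ℝ × ℝ)) (hN : IsPoissonRandomMeasure P (jumpIntensity ν) N)
    (r : ℝ) (hr : 0 < r) (x₀ xhat : ℝ) :
    -- the coefficients of the bridge are the limits of the Riccati coefficients
    (∀ F : ℝ, 0 < F → ∃ A B : ℝ → ℝ, IsRiccatiSolution r (levyMoment ν 1) xhat F A B) ∧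
    (∀ A B : ℝ → ℝ → ℝ,
      (∀ F : ℝ, 0 < F → IsRiccatiSolution r (levyMoment ν 1) xhat F (A F) (B F)) →
      ∀ t ∈ Ico (0 : ℝ) 1,
        Tendsto (fun F => A F t) atTop (𝓝 (bridgeA r t)) ∧
        Tendsto (fun F => B F t) atTop (𝓝 (bridgeB r (levyMoment ν 1) xhat t))) ∧
    -- the bridge meets the terminal constraint
    (∀ X : ℝ → Ω → ℝ, IsOUBridge P ν N r x₀ xhat X →
      ∀ᵐ ω ∂P, Tendsto (fun t => X t ω) (𝓝[<] 1) (𝓝 xhat)) := by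
  refine ⟨fun F hF => ⟨_, _, isRiccatiSolution_explicit hr hF _ _⟩, fun A B hAB t ht => ?_,
    fun X hX => hX.ae_tendsto hν hN hr⟩
  have huniq : ∀ F : ℝ, 0 < F →
      riccatiA r F t = A F t ∧ riccatiB r (levyMoment ν 1) xhat F t = B F t := fun F hF =>
    have h := (isRiccatiSolution_explicit hr hF _ _).unique (hAB F hF)
    ⟨h.1 (Ico_subset_Icc_self ht), h.2 (Ico_subset_Icc_self ht)⟩
  exact ⟨(tendsto_riccatiA hr ht.2).congr' ((eventually_gt_atTop 0).mono fun F hF =>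
      (huniq F hF).1),
    (tendsto_riccatiB hr ht.2 _ _).congr' ((eventually_gt_atTop 0).mono fun F hF =>
      (huniq F hF).2)⟩
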